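/- Let $\Bbbk$ be an algebraically closed field; all categories and functors are $\Bbbk$-linear. A category $R$, with set of objects $R_0$, is *locally bounded* if distinct objects are not isomorphic, every $R(x,x)$ is a local algebra, every $R(x,y)$ is finite-dimensional, and for every $x\in R_0$ only finitely many $y$ satisfy $R(x,y)\neq 0$ or $R(y,x)\neq 0$. Let $R$ be locally bounded and presented as $R=\Bbbk Q/I$ with $Q$ its ordinary quiver ($Q_0=R_0$, $Q_1(x,y)$ the set of arrows from $x$ to $y$) and $I$ an admissible ideal (that is, $I$ lies in the span of the paths of length at least $2$, and for each vertex $x$ it contains all sufficiently long paths starting or ending at $x$). For $\alpha\in Q_1$ let $\overline\alpha$ be the corresponding morphism of $R$. A *cycle* in $Q$ is a closed walk $C=l_n\cdots l_1$, each letter $l_i$ being an arrow or a formal inverse of an arrow. Let $g,h$ be automorphisms of $R$ that coincide on objects, and let $g^{(-)}$, $h^{(-)}$ be the $\mathbb Z$-actions $n\mapsto g^n$, $n\mapsto h^n$ on $R$. A $\mathbb Z$-equivariant functor $(\mathrm{id}_R,\eta)\colon (R,g^{(-)})\to(R,h^{(-)})$ is a family of natural isomorphisms $\eta_n\colon h^n\Rightarrow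 g^n$ $(n\in\mathbb Z)$ with $\eta_{m+n,x}=\eta_{m,g^n(x)}\circ h^m(\eta_{n,x})$; it is given by a natural isomorphism $\eta\colon h\Rightarrow g$ if $\eta_1=\eta$. An equivariant functor is an *equivariant equivalence* if its underlying functor is an equivalence. The orbit category $R/\langle g\rangle$ has the objects of $R$ and the $\mathbb Z$-graded morphism spaces $\bigoplus_{n\in\mathbb Z}R(g^n(x),y)$; the composite of $f\in R(g^n(x),y)$ and $f'\in R(g^m(y),z)$ is $f'\circ g^m(f)\in R(g^{m+n}(x),z)$. The functor $(\mathrm{id}_R,\eta)/\mathbb Z\colon R/\langle g\rangle\to R/\langle h\rangle$ is the identity on objects and sends $f\in R(g^n(x),y)$ to $f\circ\eta_{n,x}\in R(h^n(x),y)$. A functor $H\colon\mathcal B\to\mathcal A$ of $\mathbb Z$-graded categories is *strictly degree-preserving* if $H(\mathcal B^n(x,y))\subseteq\mathcal A^n(Hx,Hy)$ for all $n,x,y$, and *homogeneously dense* if every object of $\mathcal A$ is isomorphic to some $Hy$ by a homogeneous isomorphism. Consider the following statements. 1. There is a map $\rho\colon R_0\to\Bbbk^\times$ such that $\rho(y)g(f)=h(f)\rho(x)$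 for all $x,y\in R_0$ and $f\in R(x,y)$. 2. There are $c_{x,y}\in\Bbbk^\times$ $(x,y\in Q_0)$ such that (a) $(g^{-1}h)(\overline\alpha)=c_{x,y}\overline\alpha$ for all $x,y\in Q_0$ and $\alpha\in Q_1(x,y)$; and (b) for each cycle $C=l_n\cdots l_1$ in $Q$ one has $(g^{-1}h)_{l_n}\cdots(g^{-1}h)_{l_1}=1$, where $(g^{-1}h)_\alpha:=c_{x,y}$ and $(g^{-1}h)_{\alpha^{-1}}:=c_{x,y}^{-1}$ for $\alpha\in Q_1(x,y)$. 3. There is a natural isomorphism $\eta\colon h\Rightarrow g$ such that $(\mathrm{id}_R,\eta)\colon(R,g^{(-)})\to(R,h^{(-)})$ is a $\mathbb Z$-equivariant equivalence. 4. There is a natural isomorphism $\eta\colon h\Rightarrow g$ such that $(\mathrm{id}_R,\eta)$ is a $\mathbb Z$-equivariant functor and $(\mathrm{id}_R,\eta)/\mathbb Z\colon R/\langle g\rangle\to R/\langle h\rangle$ is a strictly degree-preserving, homogeneously dense equivalence of $\mathbb Z$-graded categories. Then (1) is equivalent to (2), (3) is equivalent to (4), and (1) implies (3). If $R(x,x)\cong\Bbbk$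 as algebras for all $x\in R_0$ (that is, $R$ has no nonzero oriented cycles), then (3) implies (1). -/

import Mathlib

open CategoryTheory

universe w t u v q a

namespace OrbitCat

/-! ### Locally bounded categories, presentations by quivers, walks -/

section LocallyBounded

variable (k : Type t) [Field k]

/-- A `k`-linear category is locally bounded if distinct objects are not isomorphic, endomorphism
algebras are local, morphism spaces are finite-dimensional, and every object has nonzero morphisms
to or from only finitely many objects. -/
structure IsLocallyBounded (R : Type u) [Category.{v} R] [Preadditive R] [Linear k R] :
    Prop where
  eq_of_iso : ∀ x y : R, Nonempty (x ≅ y) → x = y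
  isLocalRing_end : ∀ x : R, IsLocalRing (End x)
  finite_hom : ∀ x y : R, Module.Finite k (x ⟶ y)
  finite_support : ∀ x : R, {y : R | (∃ f : x ⟶ y, f ≠ 0) ∨ (∃ f : y ⟶ x, f ≠ 0)}.Finite

/-- `R(x, x) ≅ k` as algebras, for all objects `x`. -/
def HasNoNonzeroOrientedCycles (R : Type u) [Category.{v} R] [Preadditive R] [Linear k R] :
    Prop :=
  ∀ x : R, Nonempty (End x ≃ₐ[k] k)

/-- The `k`-linear extension to the morphism space `kQ(x, y)` (finitely supported formal linear
combinations of paths from `x` to `y`) of the functor on paths induced by a map of quivers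
`Q → R`. -/
noncomputable def pathEval {R : Type u} [Category.{v} R] [Preadditive R] [Linear k R]
    {Q : Type*} [Quiver Q] (φ : Q ⥤q R) (x y : Q) :
    (Quiver.Path x y →₀ k) →ₗ[k] (φ.obj x ⟶ φ.obj y) :=
  Finsupp.linearCombination k
    (fun p : Quiver.Path x y => ((Paths.lift φ).map (X := x) (Y := y) p : φ.obj x ⟶ φ.obj y))

/-- A presentation `R = kQ/I` of `R` as the path category of a quiver `Q` modulo an admissible
ideal `I`, so that `Q` is the ordinary quiver of `R`. The datum is `arrow : Q ⥤q R`, bijective on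
objects (`Q₀ = R₀`); it sends an arrow `α` of `Q` to the morphism `ᾱ = α + I` of `R`. The induced
linear functor `kQ → R` is full and its kernel is the ideal `I`. Admissibility of `I` means:
`I` lies in the span of the paths of length at least two, and for every vertex `x` all
sufficiently long paths that start or end at `x` lie in `I`. -/
structure Presentation (Q : Type*) [Quiver Q]
    (R : Type u) [Category.{v} R] [Preadditive R] [Linear k R] where
  arrow : Q ⥤q R
  bijective_obj : Function.Bijective arrow.obj
  surjective_eval : ∀ x y : Q, Function.Surjective (pathEval k arrow x y)
  two_le_length : ∀ (x y : Q), ∀ r ∈ LinearMap.ker (pathEval k arrow x y),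
    ∀ p ∈ r.support, 2 ≤ p.length
  exists_bound : ∀ x : Q, ∃ N : ℕ,
    (∀ (y : Q) (p : Quiver.Path x y), N ≤ p.length →
      Finsupp.single p 1 ∈ LinearMap.ker (pathEval k arrow x y)) ∧
    (∀ (y : Q) (p : Quiver.Path y x), N ≤ p.length →
      Finsupp.single p 1 ∈ LinearMap.ker (pathEval k arrow y x))

variable {k}

/-- A walk in `Q` is a path in the double quiver `Quiver.Symmetrify Q`. For scalars `c x y`, the
weight of a walk is the product of the weights of its letters, where an arrow `α` has weight
`c (s α) (t α)` and its formal inverse has the inverse weight. -/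
def walkWeight {Q : Type*} [Quiver Q] (c : Q → Q → kˣ) :
    {x y : Quiver.Symmetrify Q} → Quiver.Path x y → kˣ
  | _, _, .nil => 1
  | _, _, .cons (b := y) (c := z) w (Sum.inl _) => c y z * walkWeight c w
  | _, _, .cons (b := y) (c := z) w (Sum.inr _) => (c z y)⁻¹ * walkWeight c w

end LocallyBounded

/-! ### Two facts on `eqToHom` -/

section EqToHom

variable {C C' : Type*} [Category* C] [Category* C'] {F F' : C ⥤ C'}

theorem map_eqToHom_comp {x y : C} (h : F = F') (f : x ⟶ y) :
    F.map f = eqToHom (by rw [h]) ≫ F'.map f ≫ eqToHom (by rw [h]) := by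
  subst h; simp

theorem app_congr (τ : F ⟶ F') {x y : C} (h : x = y) :
    τ.app x = eqToHom (by rw [h]) ≫ τ.app y ≫ eqToHom (by rw [h]) := by
  subst h; simp

end EqToHom

/-! ### Automorphisms of linear categories and group actions -/

section Actions

/-- Automorphisms (strictly invertible linear endofunctors) of a `k`-linear category. -/
structure LinAut (k : Type t) [Field k] (C : Type u) [Category.{v} C] [Preadditive C]
    [Linear k C] where
  functor : C ⥤ C
  inverse : C ⥤ C
  functor_comp_inverse : functor ⋙ inverse = 𝟭 C
  inverse_comp_functor : inverse ⋙ functor = 𝟭 C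
  additive_functor : functor.Additive
  additive_inverse : inverse.Additive
  linear_functor : functor.Linear k
  linear_inverse : inverse.Linear k

attribute [instance] LinAut.additive_functor LinAut.additive_inverse LinAut.linear_functor
  LinAut.linear_inverse

namespace LinAut

variable {k : Type t} [Field k] {C : Type u} [Category.{v} C] [Preadditive C] [Linear k C]

theorem ext_functor {f g : LinAut k C} (h : f.functor = g.functor) : f = g := by
  have hi : f.inverse = g.inverse := by
    calc f.inverse = f.inverse ⋙ (g.functor ⋙ g.inverse) := by
            rw [g.functor_comp_inverse]; rfl
      _ = (f.inverse ⋙ f.functor) ⋙ g.inverse := by rw [h]; rfl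
      _ = g.inverse := by rw [f.inverse_comp_functor]; rfl
  cases f; cases g
  simp only at h hi
  subst h hi
  rfl

/-- Multiplication of automorphisms is composition: `(f * g)(x) = f (g x)`. -/
instance : Mul (LinAut k C) where
  mul f g :=
    { functor := g.functor ⋙ f.functor
      inverse := f.inverse ⋙ g.inverse
      functor_comp_inverse := by
        change g.functor ⋙ (f.functor ⋙ f.inverse) ⋙ g.inverse = _
        rw [f.functor_comp_inverse]; exact g.functor_comp_inverse
      inverse_comp_functor := by
        change f.inverse ⋙ (g.inverse ⋙ g.functor) ⋙ f.functor = _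
        rw [g.inverse_comp_functor]; exact f.inverse_comp_functor
      additive_functor := inferInstance
      additive_inverse := inferInstance
      linear_functor := inferInstance
      linear_inverse := inferInstance }

instance : One (LinAut k C) where
  one :=
    { functor := 𝟭 C
      inverse := 𝟭 C
      functor_comp_inverse := rfl
      inverse_comp_functor := rfl
      additive_functor := inferInstance
      additive_inverse := inferInstance
      linear_functor := inferInstance
      linear_inverse := inferInstance }

instance : Inv (LinAut k C) where
  inv f :=
    { functor := f.inverse
      inverse := f.functor
      functor_comp_inverse := f.inverse_comp_functor
      inverse_comp_functor := f.functor_comp_inverse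
      additive_functor := inferInstance
      additive_inverse := inferInstance
      linear_functor := inferInstance
      linear_inverse := inferInstance }

theorem mul_functor (f g : LinAut k C) : (f * g).functor = g.functor ⋙ f.functor := rfl

theorem one_functor : (1 : LinAut k C).functor = 𝟭 C := rfl

theorem inv_functor (f : LinAut k C) : f⁻¹.functor = f.inverse := rfl

instance : Group (LinAut k C) :=
  Group.ofLeftAxioms (fun _ _ _ => rfl) (fun _ => rfl)
    (fun f => ext_functor f.functor_comp_inverse)

end LinAut

variable {k : Type t} [Field k] {G : Type w} [Group G]
  {C : Type u} [Category.{v} C] [Preadditive C] [Linear k C]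

theorem act_mul_obj (X : G →* LinAut k C) (b a : G) (x : C) :
    (X (b * a)).functor.obj x = (X b).functor.obj ((X a).functor.obj x) := by
  rw [map_mul]; rfl

theorem act_one_obj (X : G →* LinAut k C) (x : C) : (X 1).functor.obj x = x := by
  rw [map_one]; rfl

/-- The `ℤ`-action `n ↦ g ^ n` given by an automorphism `g`. -/
abbrev powAction (g : LinAut k C) : Multiplicative ℤ →* LinAut k C :=
  zpowersHom (LinAut k C) g

end Actions

/-! ### Equivariant functors -/

section Equivariant

variable {k : Type t} [Field k] {G : Type w} [Group G]
  {C : Type u} [Category.{v} C] [Preadditive C] [Linear k C]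
  {C' : Type u} [Category.{v} C'] [Preadditive C'] [Linear k C']

/-- The data `η = (η_a)` that make `(F, η) : (C, X) → (C', X')` a `G`-equivariant functor: natural
isomorphisms `η_a : X'_a F ⇒ F X_a` such that `η_{ba} = (η_b X_a) (X'_b η_a)`. The morphisms
`eqToHom` only identify the equal objects `X_{ba} x = X_b X_a x` and `X'_{ba} y = X'_b X'_a y`. -/
structure EquivariantStructure (X : G →* LinAut k C) (X' : G →* LinAut k C') (F : C ⥤ C') where
  iso : ∀ a : G, F ⋙ (X' a).functor ≅ (X a).functor ⋙ F
  coherence : ∀ (a b : G) (x : C),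
    (iso (b * a)).hom.app x =
      eqToHom (act_mul_obj X' b a (F.obj x)) ≫
        (X' b).functor.map ((iso a).hom.app x) ≫
          (iso b).hom.app ((X a).functor.obj x) ≫
            eqToHom (congrArg F.obj (act_mul_obj X b a x).symm)

theorem EquivariantStructure.iso_congr {X : G →* LinAut k C} {X' : G →* LinAut k C'}
    {F : C ⥤ C'} (E : EquivariantStructure X X' F) {a b : G} (h : a = b) (x : C) :
    (E.iso a).hom.app x =
      eqToHom (by rw [h]) ≫ (E.iso b).hom.app x ≫ eqToHom (by rw [h]) := by
  subst h; simp

/-- The component `η_1` of an equivariant functor is the identity. -/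
theorem EquivariantStructure.iso_one_app {X : G →* LinAut k C} {X' : G →* LinAut k C'}
    {F : C ⥤ C'} (E : EquivariantStructure X X' F) (x : C) :
    (E.iso 1).hom.app x = eqToHom (by
      simp only [Functor.comp_obj, act_one_obj]) := by
  have h1 : (X' 1).functor = 𝟭 C' := by rw [map_one]; rfl
  have h := E.coherence 1 1 x
  rw [iso_congr E (mul_one 1) x, map_eqToHom_comp h1,
    app_congr (E.iso 1).hom (act_one_obj X x)] at h
  simp only [Functor.id_map, Category.assoc, eqToHom_trans, eqToHom_trans_assoc] at h
  rw [cancel_epi, cancel_epi, eq_comm, eqToHom_comp_iff, comp_eqToHom_iff] at h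
  rw [h]
  simp

/-- A `G`-equivariant functor `(F, η)` is a `G`-equivariant equivalence if `F` is an equivalence of
categories (that is, fully faithful and dense). -/
def EquivariantStructure.IsEquivariantEquivalence {X : G →* LinAut k C} {X' : G →* LinAut k C'}
    {F : C ⥤ C'} (_E : EquivariantStructure X X' F) : Prop :=
  F.IsEquivalence

/-- For automorphisms `g` and `h` and a natural isomorphism `η : h ⇒ g`: the equivariant structure
`E` on the identity functor `(R, g^(-)) → (R, h^(-))` is the one given by `η`, that is, its
component at the generator `1` of `ℤ` is `η` (up to `g ^ 1 = g` and `h ^ 1 = h`). -/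
def EquivariantStructure.IsInducedBy {g h : LinAut k C}
    (E : EquivariantStructure (powAction g) (powAction h) (𝟭 C)) (η : h.functor ≅ g.functor) :
    Prop :=
  ∀ x : C, (E.iso (Multiplicative.ofAdd 1)).hom.app x =
    eqToHom (by simp) ≫ η.hom.app x ≫ eqToHom (by simp)

end Equivariant

/-! ### Graded categories -/

section Graded

/-- A `G`-grading of a `k`-linear category: direct sum decompositions of all morphism spaces with
`B^b(y, z) · B^a(x, y) ⊆ B^{ba}(x, z)`. -/
class GradedCategory (k : outParam (Type t)) [Field k] (G : outParam (Type w)) [Group G]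
    [DecidableEq G] (B : Type u) [Category.{v} B] [Preadditive B] [Linear k B] where
  deg : ∀ x y : B, G → Submodule k (x ⟶ y)
  isInternal : ∀ x y : B, DirectSum.IsInternal (deg x y)
  comp_mem : ∀ {x y z : B} {a b : G} {f : x ⟶ y} {g : y ⟶ z},
    f ∈ deg x y a → g ∈ deg y z b → f ≫ g ∈ deg x z (b * a)

variable {k : Type t} [Field k] {G : Type w} [Group G] [DecidableEq G]
  {B : Type*} [Category B] [Preadditive B] [Linear k B] [GradedCategory k G B]
  {A : Type*} [Category A] [Preadditive A] [Linear k A] [GradedCategory k G A]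

/-- `H(B^a(x, y)) ⊆ A^a(H x, H y)` for all `x`, `y` and `a`. -/
def IsStrictlyDegreePreserving (H : B ⥤ A) : Prop :=
  ∀ (x y : B) (a : G) (f : x ⟶ y), f ∈ GradedCategory.deg x y a →
    H.map f ∈ GradedCategory.deg (H.obj x) (H.obj y) a

/-- Every object of `A` is isomorphic to an object `H y` by a homogeneous isomorphism. -/
def IsHomogeneouslyDense (H : B ⥤ A) : Prop :=
  ∀ x : A, ∃ (y : B) (e : x ≅ H.obj y) (a : G), e.hom ∈ GradedCategory.deg x (H.obj y) a

end Graded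

/-! ### Orbit categories -/

section Orbit

variable {k : Type t} [Field k] {G : Type w} [Group G] [DecidableEq G]
  {C : Type u} [Category.{v} C] [Preadditive C] [Linear k C]

/-- The orbit category `C/G` of a linear category `C` with (not necessarily free) `G`-action `X`.
It has the same objects as `C`. -/
@[ext]
structure OrbitCategory (X : G →* LinAut k C) where
  obj : C

namespace OrbitCategory

variable (X : G →* LinAut k C)

/-- `(C/G)(x, y) = ⨁ a, C(X_a x, y)`. -/
abbrev Hom (x y : C) : Type (max w v) := DirectSum G (fun a => ((X a).functor.obj x ⟶ y))

/-- The homogeneous morphism of degree `a` in `C/G` given by `f : X_a x ⟶ y`. -/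
abbrev single {x y : C} (a : G) : ((X a).functor.obj x ⟶ y) →ₗ[k] Hom X x y :=
  DirectSum.lof k G (fun a => ((X a).functor.obj x ⟶ y)) a

/-- Composition of homogeneous morphisms `f : X_a x ⟶ y` and `g : X_b y ⟶ z`: the morphism
`g ∘ X_b f : X_{ba} x = X_b X_a x ⟶ z` of degree `ba`. -/
noncomputable def compHomogeneous (x y z : C) (a b : G) :
    ((X a).functor.obj x ⟶ y) →ₗ[k] ((X b).functor.obj y ⟶ z) →ₗ[k] Hom X x z :=
  LinearMap.mk₂ k
    (fun f g => single X (b * a) (eqToHom (act_mul_obj X b a x) ≫ (X b).functor.map f ≫ g))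
    (fun f f' g => by simp [Functor.map_add])
    (fun c f g => by simp [Functor.map_smul])
    (fun f g g' => by simp)
    (fun c f g => by simp)

/-- Composition in `C/G`, the bilinear extension of `compHomogeneous`. -/
noncomputable def compLin (x y z : C) : Hom X x y →ₗ[k] Hom X y z →ₗ[k] Hom X x z :=
  DirectSum.toModule k G _ (fun a =>
    (DirectSum.toModule k G _ (fun b => (compHomogeneous X x y z a b).flip)).flip)

theorem compLin_single {x y z : C} (a b : G) (f : (X a).functor.obj x ⟶ y)
    (g : (X b).functor.obj y ⟶ z) :
    compLin X x y z (single X a f) (single X b g) =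
      single X (b * a) (eqToHom (act_mul_obj X b a x) ≫ (X b).functor.map f ≫ g) := by
  simp [compLin, compHomogeneous, DirectSum.toModule_lof]

theorem single_congr {x y : C} {a b : G} (h : a = b) (f : (X b).functor.obj x ⟶ y) :
    single X a (eqToHom (by rw [h]) ≫ f) = single X b f := by
  subst h; simp

theorem hom_induction {x y : C} {p : Hom X x y → Prop} (f : Hom X x y)
    (h0 : p 0) (h1 : ∀ a f, p (single X a f)) (h2 : ∀ f g, p f → p g → p (f + g)) : p f :=
  DirectSum.induction_on f h0 h1 h2

theorem id_compLin {x y : C} (f : Hom X x y) :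
    compLin X x x y (single X 1 (eqToHom (act_one_obj X x))) f = f := by
  induction f using hom_induction X with
  | h0 => simp
  | h2 f g hf hg => rw [map_add, hf, hg]
  | h1 a f =>
    rw [compLin_single, eqToHom_map, ← Category.assoc, eqToHom_trans]
    exact single_congr X (mul_one a) f

theorem compLin_id {x y : C} (f : Hom X x y) :
    compLin X x y y f (single X 1 (eqToHom (act_one_obj X y))) = f := by
  induction f using hom_induction X with
  | h0 => simp
  | h2 f g hf hg => rw [map_add, LinearMap.add_apply, hf, hg]
  | h1 a f =>
    have h1 : (X 1).functor = 𝟭 C := by rw [map_one]; rfl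
    rw [compLin_single, map_eqToHom_comp h1 f]
    simp only [Functor.id_obj, Functor.id_map, Category.assoc, eqToHom_trans, eqToHom_refl,
      Category.comp_id, eqToHom_trans_assoc]
    exact single_congr X (one_mul a) f

theorem compLin_assoc {x y z u : C} (f : Hom X x y) (g : Hom X y z) (h : Hom X z u) :
    compLin X x z u (compLin X x y z f g) h = compLin X x y u f (compLin X y z u g h) := by
  induction f using hom_induction X with
  | h0 => simp
  | h2 f f' hf hf' => simp only [map_add, LinearMap.add_apply, hf, hf']
  | h1 a f =>
  induction g using hom_induction X with
  | h0 => simp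
  | h2 f f' hf hf' => simp only [map_add, LinearMap.add_apply, hf, hf']
  | h1 b g =>
  induction h using hom_induction X with
  | h0 => simp
  | h2 f f' hf hf' => simp only [map_add, hf, hf']
  | h1 c h =>
    have hm : (X (c * b)).functor = (X b).functor ⋙ (X c).functor := by rw [map_mul]; rfl
    simp only [compLin_single]
    rw [map_eqToHom_comp hm f, ← single_congr X (mul_assoc c b a)]
    simp [eqToHom_map]

noncomputable instance : Category.{max w v} (OrbitCategory X) where
  Hom x y := Hom X x.obj y.obj
  id x := single X 1 (eqToHom (act_one_obj X x.obj))
  comp {x y z} f g := compLin X x.obj y.obj z.obj f g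
  id_comp f := id_compLin X f
  comp_id f := compLin_id X f
  assoc f g h := compLin_assoc X f g h

noncomputable instance : Preadditive (OrbitCategory X) where
  homGroup x y := inferInstanceAs (AddCommGroup (Hom X x.obj y.obj))
  add_comp x y z f f' g := LinearMap.map_add₂ (compLin X x.obj y.obj z.obj) f f' g
  comp_add x y z f g g' := LinearMap.map_add (compLin X x.obj y.obj z.obj f) g g'

noncomputable instance : Linear k (OrbitCategory X) where
  homModule x y := inferInstanceAs (Module k (Hom X x.obj y.obj))
  smul_comp x y z c f g := LinearMap.map_smul₂ (compLin X x.obj y.obj z.obj) c f g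
  comp_smul x y z f c g := LinearMap.map_smul (compLin X x.obj y.obj z.obj f) c g

/-- The degree `a` part of `(C/G)(x, y)` is `C(X_a x, y)`. -/
noncomputable def degree (x y : C) (a : G) : Submodule k (Hom X x y) :=
  LinearMap.range (single X a)

theorem isInternal_degree (x y : C) : DirectSum.IsInternal (degree X x y) := by
  have key : ∀ (d : DirectSum G (fun a => degree X x y a)) (b : G),
      single X b ((DirectSum.coeAddMonoidHom (degree X x y) d : Hom X x y) b) =
        ((d b : degree X x y b) : Hom X x y) := by
    intro d b
    induction d using DirectSum.induction_on with
    | zero => simp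
    | add d d' hd hd' => simp only [map_add, DirectSum.add_apply, hd, hd', Submodule.coe_add]
    | of a f =>
      obtain ⟨_, f, rfl⟩ := f
      rw [DirectSum.coeAddMonoidHom_of]
      by_cases h : a = b
      · subst h
        rw [DirectSum.of_eq_same]
        simp only [single, DirectSum.lof_eq_of, DirectSum.of_eq_same]
      · rw [DirectSum.of_eq_of_ne _ _ _ (Ne.symm h)]
        simp only [single, DirectSum.lof_eq_of, DirectSum.of_eq_of_ne _ _ _ (Ne.symm h), map_zero,
          Submodule.coe_zero]
  constructor
  · rw [injective_iff_map_eq_zero]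
    intro d hd
    ext b : 2
    rw [← key d b, hd]
    simp
  · intro f
    induction f using hom_induction X with
    | h0 => exact ⟨0, map_zero _⟩
    | h1 a f =>
      exact ⟨DirectSum.of (fun a => degree X x y a) a ⟨single X a f, f, rfl⟩,
        DirectSum.coeAddMonoidHom_of _ _ _⟩
    | h2 f g hf hg =>
      obtain ⟨d, rfl⟩ := hf
      obtain ⟨d', rfl⟩ := hg
      exact ⟨d + d', map_add _ _ _⟩

noncomputable instance : GradedCategory k G (OrbitCategory X) where
  deg x y := degree X x.obj y.obj
  isInternal x y := isInternal_degree X x.obj y.obj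
  comp_mem := by
    rintro x y z a b _ _ ⟨f, rfl⟩ ⟨g, rfl⟩
    exact ⟨_, (compLin_single X a b f g).symm⟩

end OrbitCategory

namespace EquivariantStructure

open OrbitCategory

variable {C' : Type u} [Category.{v} C'] [Preadditive C'] [Linear k C']
  {X : G →* LinAut k C} {X' : G →* LinAut k C'} {F : C ⥤ C'}

/-- The map `f ↦ F f ∘ η_{a, x}` on homogeneous components `C(X_a x, y) → C'(X'_a F x, F y)`. -/
noncomputable def orbitMap [F.Additive] [F.Linear k] (E : EquivariantStructure X X' F) (x y : C) :
    Hom X x y →ₗ[k] Hom X' (F.obj x) (F.obj y) :=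
  DirectSum.toModule k G _ (fun a => single X' a ∘ₗ
    Linear.leftComp k (F.obj y) ((E.iso a).hom.app x) ∘ₗ F.mapLinearMap k)

theorem orbitMap_single [F.Additive] [F.Linear k] (E : EquivariantStructure X X' F) {x y : C}
    (a : G) (f : (X a).functor.obj x ⟶ y) :
    E.orbitMap x y (single X a f) = single X' a ((E.iso a).hom.app x ≫ F.map f) := by
  simp [orbitMap, DirectSum.toModule_lof]

theorem orbitMap_comp [F.Additive] [F.Linear k] (E : EquivariantStructure X X' F) {x y z : C}
    (f : Hom X x y) (g : Hom X y z) :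
    E.orbitMap x z (compLin X x y z f g) =
      compLin X' _ _ _ (E.orbitMap x y f) (E.orbitMap y z g) := by
  induction f using hom_induction X with
  | h0 => simp
  | h2 f f' hf hf' => simp only [map_add, LinearMap.add_apply, hf, hf']
  | h1 a f =>
  induction g using hom_induction X with
  | h0 => simp
  | h2 f f' hf hf' => simp only [map_add, hf, hf']
  | h1 b g =>
    have hn := (E.iso b).hom.naturality f
    simp only [Functor.comp_map] at hn
    simp only [compLin_single, orbitMap_single, E.coherence]
    congr 1
    simp [eqToHom_map, reassoc_of% hn]

/-- The functor `(F, η)/G : C/G → C'/G` induced by a `G`-equivariant functor `(F, η)`. -/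
noncomputable def orbitFunctor [F.Additive] [F.Linear k] (E : EquivariantStructure X X' F) :
    OrbitCategory X ⥤ OrbitCategory X' where
  obj x := ⟨F.obj x.obj⟩
  map {x y} f := E.orbitMap x.obj y.obj f
  map_id x := by
    refine (E.orbitMap_single 1 _).trans ?_
    rw [iso_one_app, eqToHom_map, eqToHom_trans]
    rfl
  map_comp f g := E.orbitMap_comp f g

end EquivariantStructure
end Orbit

/-! ### The four conditions -/

section Conditions

variable {k : Type t} [Field k] {R : Type u} [Category.{v} R] [Preadditive R] [Linear k R]

theorem inv_mul_obj {g h : LinAut k R} (hgh : ∀ x : R, g.functor.obj x = h.functor.obj x) (x : R) :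
    (g⁻¹ * h).functor.obj x = x := by
  change g.inverse.obj (h.functor.obj x) = x
  rw [← hgh x]
  exact Functor.congr_obj g.functor_comp_inverse x

/-- There is `ρ : R₀ → kˣ` with `ρ(y) g(f) = h(f) ρ(x)` for all `f : x ⟶ y`. The morphisms
`eqToHom` only identify the equal objects `g x = h x` and `g y = h y`. -/
def ScalarIntertwined (g h : LinAut k R) (hgh : ∀ x : R, g.functor.obj x = h.functor.obj x) :
    Prop :=
  ∃ ρ : R → kˣ, ∀ (x y : R) (f : x ⟶ y),
    (ρ y : k) • g.functor.map f =
      eqToHom (hgh x) ≫ ((ρ x : k) • h.functor.map f) ≫ eqToHom (hgh y).symm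

/-- There are scalars `c x y` with `(g⁻¹ h)(ᾱ) = c x y ᾱ` for every arrow `α : x ⟶ y` of the
ordinary quiver, and for these scalars every cycle (closed walk) has weight `1`. The morphisms
`eqToHom` only identify the equal objects `g⁻¹ h x = x`. -/
def ScalesArrowsTrivially {Q : Type*} [Quiver Q] (P : Presentation k Q R) (g h : LinAut k R)
    (hgh : ∀ x : R, g.functor.obj x = h.functor.obj x) : Prop :=
  ∃ c : Q → Q → kˣ,
    (∀ (x y : Q) (α : x ⟶ y),
      (g⁻¹ * h).functor.map (P.arrow.map α) =
        eqToHom (inv_mul_obj hgh _) ≫ ((c x y : k) • P.arrow.map α) ≫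
          eqToHom (inv_mul_obj hgh _).symm) ∧
    ∀ (x : Quiver.Symmetrify Q) (C : Quiver.Path x x), walkWeight c C = 1

/-- There is a natural isomorphism `η : h ⇒ g` such that `(id_R, η) : (R, g^(-)) → (R, h^(-))` is a
`ℤ`-equivariant equivalence. -/
def IdEquivariantEquivalence (g h : LinAut k R) : Prop :=
  ∃ (η : h.functor ≅ g.functor)
    (E : EquivariantStructure (powAction g) (powAction h) (𝟭 R)),
    E.IsInducedBy η ∧ E.IsEquivariantEquivalence

/-- There is a natural isomorphism `η : h ⇒ g` such that `(id_R, η)/ℤ : R/⟨g⟩ → R/⟨h⟩` is a strictly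
degree-preserving and homogeneously dense equivalence of `ℤ`-graded categories. -/
def IdOrbitEquivalence (g h : LinAut k R) : Prop :=
  ∃ (η : h.functor ≅ g.functor)
    (E : EquivariantStructure (powAction g) (powAction h) (𝟭 R)),
    E.IsInducedBy η ∧ IsStrictlyDegreePreserving E.orbitFunctor ∧
      IsHomogeneouslyDense E.orbitFunctor ∧ E.orbitFunctor.IsEquivalence

end Conditions

end OrbitCat

/-! Condition (1) says that `h` is `g` followed by a diagonal rescaling: h(f) = (ρ(y)/ρ(x)) g(f) for
f : x ⟶ y.

(1) ⇔ (2): the ratios ρ(y)/ρ(x) on arrows are scalars whose products along closed walks telescope to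
1. Conversely, scalars with trivial products on closed walks are such ratios (`exists_potential`),
and an identity valid on arrows extends to paths, then to linear combinations of paths, hence to all
of R.

(1) ⇒ (3): rescalings form a group (C → kˣ), on which automorphisms act by conjugation
(`twist_conj`). So h = (g·ρ) g is the image of one element of a semidirect product whose second
component is g. The n-th power of this element is (σ_n, g^n), with image h^n, and the multiplication
rule of the semidirect product is the cocycle identity of the σ_n. The scalars σ_n(g^n x)⁻¹ are then
the components η_{n,x}, for all integers n at once.

(3) ⇔ (4): the orbit functor is the identity on objects, and on morphisms it is a direct sum of
bijections (`EquivariantStructure.orbitMap_bijective`).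

(3) ⇒ (1) when R(x,x) ≅ k: every component of η is a nonzero scalar, and naturality is (1). -/

namespace OrbitCat

/-! ### Weights of walks and potentials on a quiver. -/

section WalkWeight

variable {k : Type*} [Field k] {Q : Type*} [Quiver Q] (c : Q → Q → kˣ)

theorem walkWeight_comp {x y z : Quiver.Symmetrify Q} (p : Quiver.Path x y)
    (r : Quiver.Path y z) : walkWeight c (p.comp r) = walkWeight c r * walkWeight c p := by
  induction r with
  | nil => simp [walkWeight]
  | cons r e ih =>
    rcases e with e | e <;> simp [walkWeight, ih, mul_assoc]

/-- Scalars whose closed walks all have weight one come from a potential on the vertices. -/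
theorem exists_potential
    (hc : ∀ (x : Quiver.Symmetrify Q) (C : Quiver.Path x x), walkWeight c C = 1) :
    ∃ ρ : Q → kˣ, ∀ (x y : Q) (_ : x ⟶ y), ρ y = c x y * ρ x := by
  let s : Setoid (Quiver.Symmetrify Q) :=
    { r := fun x y => Nonempty (Quiver.Path x y)
      iseqv := ⟨fun _ => ⟨.nil⟩, fun ⟨p⟩ => ⟨p.reverse⟩, fun ⟨p⟩ ⟨r⟩ => ⟨p.comp r⟩⟩ }
  have walk (x : Quiver.Symmetrify Q) :
      Nonempty (Quiver.Path (Quotient.out (Quotient.mk s x)) x) := Quotient.mk_out (s := s) x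
  -- Closing `p` and `r` with the same return walk gives two cycles of weight 1, so that return
  -- weight cancels.
  have indep {x y : Quiver.Symmetrify Q} (p r : Quiver.Path x y) :
      walkWeight c p = walkWeight c r := by
    have h1 := hc x (p.comp p.reverse)
    have h2 := hc x (r.comp p.reverse)
    rw [walkWeight_comp] at h1 h2
    exact mul_left_cancel (h1.trans h2.symm)
  -- The potential at `x` is the weight of a walk to `x` from the chosen base vertex of its
  -- connected component.
  refine ⟨fun x => walkWeight c (walk x).some, fun x y α => ?_⟩
  have hxy : Quotient.mk s x = Quotient.mk s y :=
    Quotient.sound ⟨Quiver.Path.nil.cons (Sum.inl α)⟩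
  have key : ∀ (b : Quiver.Symmetrify Q) (p : Quiver.Path b x) (r : Quiver.Path b y),
      walkWeight c r = c x y * walkWeight c p := fun b p r =>
    (indep r (p.cons (Sum.inl α))).trans (walkWeight.eq_2 c ..)
  -- The base vertices chosen for `x` and `y` are only propositionally equal, so both are
  -- generalized before being identified.
  have key' : ∀ (b b' : Quiver.Symmetrify Q) (_ : b = b') (p : Quiver.Path b x)
      (r : Quiver.Path b' y), walkWeight c r = c x y * walkWeight c p := by
    rintro b _ rfl p r
    exact key b p r
  exact key' _ _ (congrArg Quotient.out hxy) _ _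

/-- The weight of a walk for scalars coming from a potential. -/
theorem walkWeight_of_potential (ρ : Q → kˣ) {x y : Quiver.Symmetrify Q} (p : Quiver.Path x y) :
    walkWeight (fun x y => ρ y * (ρ x)⁻¹) p = ρ y * (ρ x)⁻¹ := by
  induction p with
  | nil => simp [walkWeight]
  | cons r e ih =>
    rcases e with e | e <;> simp [walkWeight, ih]

end WalkWeight

/-! ### Diagonal rescalings of a linear category. -/

section ScalarTwist

variable {k : Type t} [Field k] {C : Type u} [Category.{v} C] [Preadditive C] [Linear k C]

/-- The endofunctor that fixes the objects and scales `f : x ⟶ y` by `σ y / σ x`. -/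
@[simps]
def twistFunctor (σ : C → kˣ) : C ⥤ C where
  obj x := x
  map {x y} f := ((σ y * (σ x)⁻¹ : kˣ) : k) • f
  map_comp {x y z} f g := by
    rw [Linear.smul_comp, Linear.comp_smul, smul_smul, ← Units.val_mul]
    congr 2
    rw [mul_comm (σ y), mul_comm (σ z), mul_assoc, mul_comm (σ z), mul_inv_cancel_left]

instance (σ : C → kˣ) : (twistFunctor σ).Additive where
  map_add := smul_add _ _ _

instance (σ : C → kˣ) : (twistFunctor σ).Linear k where
  map_smul {x y} f c := smul_comm ((σ y * (σ x)⁻¹ : kˣ) : k) c f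

theorem twistFunctor_mul (σ τ : C → kˣ) :
    twistFunctor (σ * τ) = twistFunctor τ ⋙ twistFunctor σ := by
  refine Functor.hext (fun _ => rfl) fun x y f => heq_of_eq ?_
  change ((σ y * τ y * (σ x * τ x)⁻¹ : kˣ) : k) • f =
    ((σ y * (σ x)⁻¹ : kˣ) : k) • ((τ y * (τ x)⁻¹ : kˣ) : k) • f
  rw [smul_smul, ← Units.val_mul, mul_inv, mul_mul_mul_comm]

theorem twistFunctor_one : twistFunctor (1 : C → kˣ) = 𝟭 C :=
  Functor.hext (fun _ => rfl) fun x y f => heq_of_eq (by simp; rfl)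

/-- The automorphisms that fix the objects and scale `f : x ⟶ y` by `σ y / σ x`. -/
def twist : (C → kˣ) →* LinAut k C where
  toFun σ :=
    { functor := twistFunctor σ
      inverse := twistFunctor σ⁻¹
      functor_comp_inverse := by
        rw [← twistFunctor_mul, inv_mul_cancel, twistFunctor_one]
      inverse_comp_functor := by
        rw [← twistFunctor_mul, mul_inv_cancel, twistFunctor_one]
      additive_functor := inferInstance
      additive_inverse := inferInstance
      linear_functor := inferInstance
      linear_inverse := inferInstance }
  map_one' := LinAut.ext_functor twistFunctor_one
  map_mul' σ τ := LinAut.ext_functor (twistFunctor_mul σ τ)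

/-- Through this action `mulAutArrow a σ` is σ ∘ a⁻¹, a function on objects. -/
instance : MulAction (LinAut k C) C where
  smul a x := a.functor.obj x
  one_smul _ := rfl
  mul_smul _ _ _ := rfl

/-- Both sides scale a(f) by σ(y)/σ(x), because σ ∘ a⁻¹ takes the value σ(z) at a(z). This is the
compatibility needed to map out of the semidirect product. -/
theorem twist_conj (a : LinAut k C) (σ : C → kˣ) :
    twist (mulAutArrow a σ) * a = a * twist σ := by
  refine LinAut.ext_functor (Functor.hext (fun _ => rfl) fun x y f => heq_of_eq ?_)
  have key (z : C) : mulAutArrow a σ (a.functor.obj z) = σ z :=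
    congrArg σ (inv_smul_smul a z)
  change ((mulAutArrow a σ (a.functor.obj y) * (mulAutArrow a σ (a.functor.obj x))⁻¹ : kˣ) : k) •
    a.functor.map f = a.functor.map (((σ y * (σ x)⁻¹ : kˣ) : k) • f)
  rw [key, key, Functor.map_smul]

/-- Scalar twists followed by arbitrary automorphisms. -/
def twistLift : (C → kˣ) ⋊[mulAutArrow] LinAut k C →* LinAut k C :=
  SemidirectProduct.lift twist (MonoidHom.id _) fun a => by
    ext1 σ
    simp only [MonoidHom.comp_apply, MulEquiv.coe_toMonoidHom, MulAut.conj_apply,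
      MonoidHom.id_apply]
    rw [← twist_conj, mul_inv_cancel_right]

theorem twistLift_apply (s : (C → kˣ) ⋊[mulAutArrow] LinAut k C) :
    twistLift s = twist s.left * s.right := rfl

/-- Functors with the same values on objects whose values on morphisms differ by the scalars
`σ y / σ x` are isomorphic by scalars. -/
@[simps!]
def scalarIso {F G : C ⥤ C} (σ : C → kˣ) (hobj : ∀ x, F.obj x = G.obj x)
    (hmap : ∀ (x y : C) (f : x ⟶ y), F.map f =
      eqToHom (hobj x) ≫ (((σ y * (σ x)⁻¹ : kˣ) : k) • G.map f) ≫ eqToHom (hobj y).symm) :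
    F ≅ G :=
  NatIso.ofComponents
    (fun x =>
      { hom := (((σ x)⁻¹ : kˣ) : k) • eqToHom (hobj x)
        inv := (σ x : k) • eqToHom (hobj x).symm
        hom_inv_id := by
          rw [Linear.smul_comp, Linear.comp_smul, smul_smul, Units.inv_mul, one_smul,
            eqToHom_trans, eqToHom_refl]
        inv_hom_id := by
          rw [Linear.smul_comp, Linear.comp_smul, smul_smul, Units.mul_inv, one_smul,
            eqToHom_trans, eqToHom_refl] })
    (fun {x y} f => by
      simp only [hmap, Linear.comp_smul, Linear.smul_comp, smul_smul, Category.assoc,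
        eqToHom_trans, eqToHom_refl, Category.comp_id, ← Units.val_mul, inv_mul_cancel_left])

theorem map_of_eq_twist_mul {σ : C → kˣ} {a b : LinAut k C} (hab : b = twist σ * a)
    (hobj : ∀ x, b.functor.obj x = a.functor.obj x) {x y : C} (f : x ⟶ y) :
    b.functor.map f = eqToHom (hobj x) ≫
      (((σ (a.functor.obj y) * (σ (a.functor.obj x))⁻¹ : kˣ) : k) • a.functor.map f) ≫
        eqToHom (hobj y).symm := by
  subst hab
  exact ((Category.id_comp _).trans (Category.comp_id _)).symm

/-- A group action and its twist by a scalar cocycle are related by an equivariant structure on the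
identity functor. -/
def twistEquivariantStructure {G : Type w} [Group G] {X X' : G →* LinAut k C}
    (σ : G → C → kˣ) (hX : ∀ a, X' a = twist (σ a) * X a)
    (hσ : ∀ a b x, σ (b * a) ((X (b * a)).functor.obj x) =
      σ b ((X b).functor.obj ((X a).functor.obj x)) * σ a ((X a).functor.obj x)) :
    EquivariantStructure X X' (𝟭 C) where
  iso a := scalarIso (F := (X' a).functor) (G := (X a).functor)
    -- The rescaling acts after `X a`, so its scalar is read at the object `X a` sends `x` to.
    (fun x => σ a ((X a).functor.obj x)) (fun x => by rw [hX]; rfl)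
    (fun x y f => map_of_eq_twist_mul (hX a) (fun x => by rw [hX]; rfl) f)
  coherence a b x := by
    simp only [scalarIso_hom_app, hσ, Functor.map_smul, eqToHom_map, Linear.smul_comp,
      Linear.comp_smul, smul_smul, eqToHom_trans, mul_inv, Units.val_mul]

end ScalarTwist

/-! ### Evaluation of paths; transport along equalities of functors. -/

section Auxiliary

variable {R : Type u} [Category.{v} R]

/-- The morphism of `R` given by a path. -/
def pathMap {Q : Type*} [Quiver Q] (φ : Q ⥤q R) {x y : Q} (p : Quiver.Path x y) :
    φ.obj x ⟶ φ.obj y :=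
  (Paths.lift φ).map (X := x) (Y := y) p

theorem pathMap_nil {Q : Type*} [Quiver Q] (φ : Q ⥤q R) (x : Q) :
    pathMap φ (.nil : Quiver.Path x x) = 𝟙 _ := rfl

theorem pathMap_cons {Q : Type*} [Quiver Q] (φ : Q ⥤q R) {x y z : Q} (p : Quiver.Path x y)
    (α : y ⟶ z) : pathMap φ (p.cons α) = pathMap φ p ≫ φ.map α := rfl

/-- Used to pass from the component at the generator of ℤ, which relates h^1 and g^1, to an
isomorphism h ⇒ g. -/
theorem hom_app_eq_eqToIso_conj {F F' G G' : R ⥤ R} (hF : F' = F) (hG : G = G') (τ : F ≅ G)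
    (x : R) (h₁ : F.obj x = F'.obj x) (h₂ : G'.obj x = G.obj x) :
    τ.hom.app x = eqToHom h₁ ≫ (eqToIso hF ≪≫ τ ≪≫ eqToIso hG).hom.app x ≫ eqToHom h₂ := by
  subst hF hG
  simp

end Auxiliary

/-! ### The implications between the four conditions. -/

section Conditions

variable {k : Type t} [Field k] {R : Type u} [Category.{v} R] [Preadditive R] [Linear k R]

/-- Applying the faithful functor `g` removes g⁻¹ and turns the condition on arrows into the shape
of the intertwining relation. -/
theorem inv_mul_map_eq_iff {g h : LinAut k R}
    (hgh : ∀ x : R, g.functor.obj x = h.functor.obj x) {x y : R} (f : x ⟶ y) (c : kˣ) :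
    (g⁻¹ * h).functor.map f =
        eqToHom (inv_mul_obj hgh _) ≫ ((c : k) • f) ≫ eqToHom (inv_mul_obj hgh _).symm ↔
      (c : k) • g.functor.map f =
        eqToHom (hgh x) ≫ h.functor.map f ≫ eqToHom (hgh y).symm := by
  have hg : h.functor = (g⁻¹ * h).functor ⋙ g.functor := by
    rw [← LinAut.mul_functor, mul_inv_cancel_left]
  have hg' : g.functor.Faithful := by
    have : (g.functor ⋙ g.inverse).Faithful := by
      rw [g.functor_comp_inverse]; infer_instance
    exact Functor.Faithful.of_comp g.functor g.inverse
  rw [map_eqToHom_comp hg f, ← g.functor.map_injective.eq_iff]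
  simp only [Functor.map_comp, eqToHom_map, Functor.map_smul, Functor.comp_map,
    eqToHom_trans_assoc, Category.assoc, eqToHom_trans]
  rw [eq_comm, eqToHom_comp_iff, comp_eqToHom_iff]
  simp

theorem ScalarIntertwined.scalesArrowsTrivially {Q : Type*} [Quiver Q] (P : Presentation k Q R)
    {g h : LinAut k R} {hgh : ∀ x : R, g.functor.obj x = h.functor.obj x}
    (H : ScalarIntertwined g h hgh) : ScalesArrowsTrivially P g h hgh := by
  obtain ⟨ρ, hρ⟩ := H
  refine ⟨fun x y => ρ (P.arrow.obj y) * (ρ (P.arrow.obj x))⁻¹, fun x y α => ?_, fun x C => ?_⟩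
  · rw [inv_mul_map_eq_iff]
    dsimp only
    rw [mul_comm, Units.val_mul, mul_smul, hρ, Linear.smul_comp, Linear.comp_smul,
      smul_smul, Units.inv_mul, one_smul]
  · exact (walkWeight_of_potential (fun x => ρ (P.arrow.obj x)) C).trans (mul_inv_cancel _)

theorem pathEval_single {Q : Type*} [Quiver Q] (φ : Q ⥤q R) {x y : Q} (p : Quiver.Path x y)
    (c : k) : pathEval k φ x y (Finsupp.single p c) = c • pathMap φ p :=
  Finsupp.linearCombination_single k c p

theorem ScalesArrowsTrivially.scalarIntertwined {Q : Type*} [Quiver Q] {P : Presentation k Q R}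
    {g h : LinAut k R} {hgh : ∀ x : R, g.functor.obj x = h.functor.obj x}
    (H : ScalesArrowsTrivially P g h hgh) : ScalarIntertwined g h hgh := by
  obtain ⟨c, hc, hw⟩ := H
  obtain ⟨ρ, hρ⟩ := exists_potential c hw
  have harrow {x y : Q} (α : x ⟶ y) : (ρ y : k) • g.functor.map (P.arrow.map α) =
      eqToHom (hgh _) ≫ ((ρ x : k) • h.functor.map (P.arrow.map α)) ≫ eqToHom (hgh _).symm := by
    rw [hρ x y α, mul_comm, Units.val_mul, mul_smul, (inv_mul_map_eq_iff hgh _ _).1 (hc x y α),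
      Linear.smul_comp, Linear.comp_smul]
  have hpath {x y : Q} (p : Quiver.Path x y) : (ρ y : k) • g.functor.map (pathMap P.arrow p) =
      eqToHom (hgh _) ≫ ((ρ x : k) • h.functor.map (pathMap P.arrow p)) ≫
        eqToHom (hgh _).symm := by
    induction p with
    | nil => simp [pathMap_nil]
    -- The scalar at the end of the arrow is moved across it to the middle vertex, where the
    -- induction hypothesis takes over.
    | @cons y z p α ih =>
      rw [pathMap_cons, Functor.map_comp, ← Linear.comp_smul, harrow, Linear.smul_comp,
        Linear.comp_smul, Linear.comp_smul, ← Linear.smul_comp, ih]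
      simp
  obtain ⟨e, he⟩ := Function.bijective_iff_has_inverse.1 P.bijective_obj
  have hlin (x y : Q) (f : P.arrow.obj x ⟶ P.arrow.obj y) :
      (ρ y : k) • g.functor.map f =
        eqToHom (hgh _) ≫ ((ρ x : k) • h.functor.map f) ≫ eqToHom (hgh _).symm := by
    obtain ⟨f, rfl⟩ := P.surjective_eval x y f
    induction f using Finsupp.induction_linear with
    | zero => simp
    | add f f' hf hf' =>
      simp only [map_add, Functor.map_add, smul_add, hf, hf', Preadditive.comp_add,
        Preadditive.add_comp]
    | single p c =>
      rw [pathEval_single, Functor.map_smul, Functor.map_smul,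
        smul_comm, hpath, smul_comm]
      simp only [Linear.smul_comp, Linear.comp_smul]
  refine ⟨fun x => ρ (e x), fun x y f => ?_⟩
  obtain ⟨x, rfl⟩ := P.bijective_obj.2 x
  obtain ⟨y, rfl⟩ := P.bijective_obj.2 y
  simp only [he.1 x, he.1 y]
  exact hlin x y f

/-- The twist is composed after `g`, so ρ must be carried to the objects g(x); this is why
`mulAutArrow g ρ` appears. -/
theorem ScalarIntertwined.eq_twist_mul
    {g h : LinAut k R} {hgh : ∀ x : R, g.functor.obj x = h.functor.obj x} {ρ : R → kˣ}
    (hρ : ∀ (x y : R) (f : x ⟶ y), (ρ y : k) • g.functor.map f =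
      eqToHom (hgh x) ≫ ((ρ x : k) • h.functor.map f) ≫ eqToHom (hgh y).symm) :
    h = twist (mulAutArrow g ρ) * g := by
  refine LinAut.ext_functor (CategoryTheory.Functor.ext (fun x => (hgh x).symm) fun x y f => ?_)
  have key (z : R) : mulAutArrow g ρ (g.functor.obj z) = ρ z :=
    congrArg ρ (inv_smul_smul g z)
  have hf : h.functor.map f = eqToHom (hgh x).symm ≫
      (((ρ y * (ρ x)⁻¹ : kˣ) : k) • g.functor.map f) ≫ eqToHom (hgh y) := by
    rw [mul_comm, Units.val_mul, mul_smul, hρ]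
    simp [smul_smul]
  rw [← key x, ← key y] at hf
  exact hf

theorem ScalarIntertwined.idEquivariantEquivalence
    {g h : LinAut k R} {hgh : ∀ x : R, g.functor.obj x = h.functor.obj x}
    (H : ScalarIntertwined g h hgh) : IdEquivariantEquivalence g h := by
  obtain ⟨ρ, hρ⟩ := H
  -- Taking powers in the semidirect product yields the scalar cocycle as `(s n).left`, negative
  -- exponents included.
  let s : Multiplicative ℤ →* (R → kˣ) ⋊[mulAutArrow] LinAut k R :=
    zpowersHom _ ⟨mulAutArrow g ρ, g⟩
  -- Homomorphisms from ℤ agree once they agree on the generator; the same argument identifies the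
  -- action of `h`.
  have hs : SemidirectProduct.rightHom.comp s = powAction g := by
    ext1
    exact (congrArg SemidirectProduct.right (zpow_one _)).trans (zpow_one g).symm
  have hs' : twistLift.comp s = powAction h := by
    ext1
    exact (congrArg twistLift (zpow_one _)).trans ((eq_twist_mul hρ).symm.trans (zpow_one h).symm)
  have hr (a : Multiplicative ℤ) : (s a).right = powAction g a := by rw [← hs]; rfl
  let E : EquivariantStructure (powAction g) (powAction h) (𝟭 R) :=
    twistEquivariantStructure (fun a => (s a).left)
      (fun a => by rw [← hs', ← hs]; exact twistLift_apply _)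
      (fun a b x => by
        rw [map_mul, map_mul, SemidirectProduct.mul_left, hr]
        exact congrArg (fun z => (s b).left _ * (s a).left z)
          (inv_smul_smul (powAction g b) ((powAction g a).functor.obj x)))
  have h1 (g : LinAut k R) : g = powAction g (Multiplicative.ofAdd 1) := by simp
  refine ⟨eqToIso (congrArg LinAut.functor (h1 h)) ≪≫ E.iso (Multiplicative.ofAdd 1) ≪≫
    eqToIso (congrArg LinAut.functor (h1 g)).symm, E, fun x => ?_, ?_⟩
  · exact hom_app_eq_eqToIso_conj _ _ _ _ _ _
  · exact inferInstanceAs (𝟭 R).IsEquivalence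

theorem IdEquivariantEquivalence.scalarIntertwined {g h : LinAut k R}
    (hgh : ∀ x : R, g.functor.obj x = h.functor.obj x) (hR : HasNoNonzeroOrientedCycles k R)
    (H : IdEquivariantEquivalence g h) : ScalarIntertwined g h hgh := by
  obtain ⟨η, -⟩ := H
  have hscalar (x : R) (f : End x) : ∃ c : k, f = c • 𝟙 x := by
    obtain ⟨e⟩ := hR x
    refine ⟨e f, e.injective ?_⟩
    have h1 : e (𝟙 x) = 1 := map_one e
    rw [map_smul, h1, smul_eq_mul, mul_one]
  -- Since g(x) = h(x), the component is an endomorphism, hence a scalar. The scalar is nonzero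
  -- because an isomorphism equal to 0 would make the identity 0 in an endomorphism algebra
  -- isomorphic to k.
  have hη (x : R) : ∃ c : kˣ, η.hom.app x = (c : k) • eqToHom (hgh x).symm := by
    obtain ⟨c, hc⟩ := hscalar _ (η.hom.app x ≫ eqToHom (hgh x))
    have h0 : c ≠ 0 := by
      rintro rfl
      rw [zero_smul] at hc
      obtain ⟨e⟩ := hR (h.functor.obj x)
      have h1 : e (𝟙 _) = 1 := map_one e
      have hid : 𝟙 (h.functor.obj x) = 0 := by
        rw [← cancel_epi (η.hom.app x ≫ eqToHom (hgh x)), hc]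
        simp
      rw [hid, map_zero] at h1
      exact zero_ne_one h1
    refine ⟨Units.mk0 c h0, ?_⟩
    rw [← cancel_mono (eqToHom (hgh x)), hc]
    simp
  choose ρ hρ using hη
  -- Inverses occur because η runs from h to g, while the scalars of (1) multiply in the opposite
  -- direction.
  refine ⟨fun x => (ρ x)⁻¹, fun x y f => ?_⟩
  have hn := η.hom.naturality f
  rw [hρ, hρ, Linear.comp_smul, Linear.smul_comp] at hn
  have hn' : h.functor.map f ≫ eqToHom (hgh y).symm =
      (((ρ y)⁻¹ * ρ x : kˣ) : k) • (eqToHom (hgh x).symm ≫ g.functor.map f) := by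
    rw [Units.val_mul, mul_smul, ← hn, smul_smul, Units.inv_mul, one_smul]
  rw [Linear.smul_comp, Linear.comp_smul, hn', Linear.comp_smul, smul_smul, ← Units.val_mul,
    mul_comm ((ρ y)⁻¹), inv_mul_cancel_left, eqToHom_trans_assoc, eqToHom_refl, Category.id_comp]

/-- In each degree the map is the bijection given by `F` on morphisms followed by precomposition
with an isomorphism; a direct sum of bijections is bijective. -/
theorem EquivariantStructure.orbitMap_bijective {G : Type w} [Group G] [DecidableEq G]
    {C : Type u} [Category.{v} C] [Preadditive C] [Linear k C]
    {C' : Type u} [Category.{v} C'] [Preadditive C'] [Linear k C']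
    {X : G →* LinAut k C} {X' : G →* LinAut k C'} {F : C ⥤ C'} [F.Additive] [F.Linear k]
    [F.Full] [F.Faithful] (E : EquivariantStructure X X' F) (x y : C) :
    Function.Bijective (E.orbitMap x y) := by
  let φ (a : G) : ((X a).functor.obj x ⟶ y) →ₗ[k] ((X' a).functor.obj (F.obj x) ⟶ F.obj y) :=
    Linear.leftComp k (F.obj y) ((E.iso a).hom.app x) ∘ₗ F.mapLinearMap k
  have hφ (a : G) : Function.Bijective (φ a) :=
    ((E.iso a).app x).symm.homFromEquiv.bijective.comp 
      (f := F.map) ⟨F.map_injective, F.map_surjective⟩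
  have h : E.orbitMap x y = DirectSum.lmap φ := by
    refine DirectSum.linearMap_ext k fun a => LinearMap.ext fun f => ?_
    exact (E.orbitMap_single a f).trans (DirectSum.lmap_lof φ a f).symm
  rw [h]
  exact ⟨(DirectSum.lmap_injective φ).2 fun a => (hφ a).1,
    (DirectSum.lmap_surjective φ).2 fun a => (hφ a).2⟩

theorem EquivariantStructure.isStrictlyDegreePreserving_orbitFunctor
    {G : Type w} [Group G] [DecidableEq G]
    {C : Type u} [Category.{v} C] [Preadditive C] [Linear k C]
    {C' : Type u} [Category.{v} C'] [Preadditive C'] [Linear k C']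
    {X : G →* LinAut k C} {X' : G →* LinAut k C'} {F : C ⥤ C'} [F.Additive] [F.Linear k]
    (E : EquivariantStructure X X' F) : IsStrictlyDegreePreserving E.orbitFunctor := by
  rintro x y a _ ⟨f, rfl⟩
  exact ⟨_, (E.orbitMap_single a f).symm⟩

theorem idEquivariantEquivalence_iff_idOrbitEquivalence (g h : LinAut k R) :
    IdEquivariantEquivalence g h ↔ IdOrbitEquivalence g h := by
  constructor
  · rintro ⟨η, E, hη, -⟩
    -- Identities are homogeneous of degree `1`, the neutral element of `Multiplicative ℤ`, that is,
    -- integer degree 0.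
    have hd : IsHomogeneouslyDense E.orbitFunctor := fun x =>
      ⟨⟨x.obj⟩, Iso.refl x, 1, ⟨eqToHom (act_one_obj (powAction h) x.obj), rfl⟩⟩
    refine ⟨η, E, hη, E.isStrictlyDegreePreserving_orbitFunctor, hd, ?_⟩
    exact
      { full := ⟨fun {x y} => (E.orbitMap_bijective x.obj y.obj).2⟩
        faithful := ⟨fun {x y} => (E.orbitMap_bijective x.obj y.obj).1⟩
        essSurj := ⟨fun x => ⟨⟨x.obj⟩, ⟨Iso.refl x⟩⟩⟩ }
  · rintro ⟨η, E, hη, -⟩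
    exact ⟨η, E, hη, inferInstanceAs (𝟭 R).IsEquivalence⟩

end Conditions
end OrbitCat

theorem proposition3p6 {k : Type t} [Field k] [IsAlgClosed k]
    {R : Type u} [Category.{v} R] [Preadditive R] [Linear k R]
    (hR : OrbitCat.IsLocallyBounded k R)
    (g h : OrbitCat.LinAut k R) (hgh : ∀ x : R, g.functor.obj x = h.functor.obj x) :
    (∀ (Q : Type q) [Quiver.{a} Q] (P : OrbitCat.Presentation k Q R),
      OrbitCat.ScalarIntertwined g h hgh ↔ OrbitCat.ScalesArrowsTrivially P g h hgh) ∧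
    (OrbitCat.IdEquivariantEquivalence g h ↔ OrbitCat.IdOrbitEquivalence g h) ∧
    (OrbitCat.ScalarIntertwined g h hgh → OrbitCat.IdEquivariantEquivalence g h) ∧
    (OrbitCat.HasNoNonzeroOrientedCycles k R →
      OrbitCat.IdEquivariantEquivalence g h → OrbitCat.ScalarIntertwined g h hgh) := 
  ⟨fun _ _ P => ⟨fun H => H.scalesArrowsTrivially P, fun H => H.scalarIntertwined⟩,
    OrbitCat.idEquivariantEquivalence_iff_idOrbitEquivalence g h,
    fun H => H.idEquivariantEquivalence, fun hk H => H.scalarIntertwined hgh hk⟩
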